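/- Let $d\ge 1$, $\mathcal H=\mathbb C^d$. A quantum channel is a completely positive trace-preserving linear map $\mathcal E$ on operators on $\mathcal H$; it is $\epsilon$-locally differentially private ($\mathcal E\in\mathrm{LDP}_\epsilon$) if $\mathrm{Tr}(M\mathcal E(\rho))\le e^{\epsilon}\,\mathrm{Tr}(M\mathcal E(\sigma))$ for all $0\preceq M\preceq I$ and all density operators $\rho,\sigma$. Let $(\rho_\lambda)_{\lambda\in\mathbb R}$ be a continuously differentiable family of density operators on $\mathcal H$. For $N\ge 1$, an estimator $\hat\lambda$ based on $\mathcal E(\rho_\lambda)^{\otimes N}$ is a finite-outcome POVM on $\mathcal H^{\otimes N}$ with a real estimate attached to each outcome. It is (locally) unbiased at $\lambda$ if $\mathbb E_{\lambda'}\{\hat\lambda\}=\lambda'$ holds to first order at $\lambda'=\lambda$, i.e. $\mathbb E_{\lambda}\{\hat\lambda\}=\lambda$ and $\partial_{\lambda'}\mathbb E_{\lambda'}\{\hat\lambda\}|_{\lambda'=\lambda}=1$. For $\alpha>0$ let $N_\alpha(\mathcal E)\in\mathbb N\cup\{\infty\}$ be the least $N\ge1$ for which there is an estimator based on $\mathcal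 E(\rho_\lambda)^{\otimes N}$ that is unbiased at $\lambda$ and satisfies $\mathbb E_\lambda\{(\lambda-\hat\lambda)^2\}\le\alpha$, and let $N_{\alpha,\epsilon}=\inf_{\mathcal E\in\mathrm{LDP}_\epsilon}N_\alpha(\mathcal E)$ be the best-case sample complexity at $\lambda$. Proposition. $N_{\alpha,\epsilon}=\mathcal O(d\,\alpha^{-1}\epsilon^{-2})$ for small $\epsilon$, and this is attained by the global depolarizing channel $\mathcal E(X)=\frac pd\mathrm{Tr}(X)I+(1-p)X$ with $p=\frac{d}{d-1+e^\epsilon}$. Precisely: there is an absolute constant $c>0$ such that for all $m>0$ and $\alpha_0>0$ there is $\epsilon_0>0$, depending only on $m$ and $\alpha_0$, with the following property. For every $d$, every family $(\rho_\lambda)$ as above, every $\lambda$ at which the Hilbert–Schmidt norm satisfies $\|\partial_\lambda\rho_\lambda\|_{2}\ge m$, every $\alpha\in(0,\alpha_0]$ and every $\epsilon\in(0,\epsilon_0)$, $$N_{\alpha,\epsilon}\le \frac{c}{m^2}\cdot\frac{d}{\alpha\,\epsilon^{2}},$$ and moreover the global depolarizing map $\mathcal E$ with $p=d/(d-1+e^\epsilon)$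 is a quantum channel, belongs to $\mathrm{LDP}_\epsilon$, and satisfies $N_\alpha(\mathcal E)\le \frac{c}{m^2}\,d\,\alpha^{-1}\epsilon^{-2}$. -/

import Mathlib

open scoped ComplexOrder ENNReal

noncomputable section

namespace QuantumLDP

/-- Density operators on `ℂ^ι`: positive semidefinite with unit trace. -/
structure IsDensity {ι : Type*} [Fintype ι] (ρ : Matrix ι ι ℂ) : Prop where
  posSemidef : ρ.PosSemidef
  trace_eq_one : ρ.trace = 1

/-- The map `id_k ⊗ Φ` on operators on `ℂ^k ⊗ ℂ^d`: `Φ` is applied to each `d × d` block. -/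
def ampliation {d : ℕ} (Φ : Matrix (Fin d) (Fin d) ℂ →ₗ[ℂ] Matrix (Fin d) (Fin d) ℂ) (k : ℕ)
    (X : Matrix (Fin k × Fin d) (Fin k × Fin d) ℂ) :
    Matrix (Fin k × Fin d) (Fin k × Fin d) ℂ :=
  Matrix.of fun a b => Φ (Matrix.of fun i j => X (a.1, i) (b.1, j)) a.2 b.2

/-- Quantum channels on a `d`-dimensional system: completely positive, trace-preserving
linear maps. -/
structure QuantumChannel (d : ℕ) where
  toLinearMap : Matrix (Fin d) (Fin d) ℂ →ₗ[ℂ] Matrix (Fin d) (Fin d) ℂ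
  completelyPositive : ∀ (k : ℕ) (X : Matrix (Fin k × Fin d) (Fin k × Fin d) ℂ),
    X.PosSemidef → (ampliation toLinearMap k X).PosSemidef
  tracePreserving : ∀ X : Matrix (Fin d) (Fin d) ℂ, (toLinearMap X).trace = X.trace

/-- `ε`-local differential privacy: `Tr(M E(ρ)) ≤ e^ε Tr(M E(σ))` for all `0 ≤ M ≤ I` and all
density operators `ρ, σ`. -/
def QuantumChannel.IsLDP {d : ℕ} (E : QuantumChannel d) (ε : ℝ) : Prop :=
  ∀ M ρ σ : Matrix (Fin d) (Fin d) ℂ, M.PosSemidef → (1 - M).PosSemidef →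
    IsDensity ρ → IsDensity σ →
    (M * E.toLinearMap ρ).trace.re ≤ Real.exp ε * (M * E.toLinearMap σ).trace.re

/-- The global depolarizing map `X ↦ (p / d) Tr(X) I + (1 - p) X`. -/
def depolarizingMap (d : ℕ) (p : ℝ) :
    Matrix (Fin d) (Fin d) ℂ →ₗ[ℂ] Matrix (Fin d) (Fin d) ℂ where
  toFun X := (((p / d : ℝ) : ℂ) * X.trace) • (1 : Matrix (Fin d) (Fin d) ℂ)
    + ((1 - p : ℝ) : ℂ) • X
  map_add' X Y := by
    simp only [Matrix.trace_add, mul_add, add_smul, smul_add]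
    abel
  map_smul' a X := by
    simp only [Matrix.trace_smul, smul_eq_mul, RingHom.id_apply, smul_add, smul_smul]
    congr 2 <;> ring

/-- The `N`-fold tensor power `ρ^{⊗N}`, in the product basis of `(ℂ^d)^{⊗N}`, which is indexed
by `Fin N → Fin d`. -/
def tensorPower {d : ℕ} (N : ℕ) (ρ : Matrix (Fin d) (Fin d) ℂ) :
    Matrix (Fin N → Fin d) (Fin N → Fin d) ℂ :=
  Matrix.of fun x y => ∏ s, ρ (x s) (y s)

/-- A scalar estimator based on `N` copies of a `d`-dimensional system: a POVM
`(M_1, …, M_k)` on the `N` copies together with the real estimate reported at each outcome. -/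
structure Estimator (d N : ℕ) where
  outcomes : ℕ
  effect : Fin outcomes → Matrix (Fin N → Fin d) (Fin N → Fin d) ℂ
  effect_posSemidef : ∀ j, (effect j).PosSemidef
  sum_effect : ∑ j, effect j = 1
  estimate : Fin outcomes → ℝ

/-- The probability `Tr(M_j τ^{⊗N})` of outcome `j`, when each of the `N` systems is in the
state `τ`. -/
def Estimator.prob {d N : ℕ} (T : Estimator d N) (τ : Matrix (Fin d) (Fin d) ℂ)
    (j : Fin T.outcomes) : ℝ :=
  (T.effect j * tensorPower N τ).trace.re

/-- The expectation of the estimate. -/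
def Estimator.mean {d N : ℕ} (T : Estimator d N) (τ : Matrix (Fin d) (Fin d) ℂ) : ℝ :=
  ∑ j, T.prob τ j * T.estimate j

/-- The mean squared error with respect to the value `θ`. -/
def Estimator.mse {d N : ℕ} (T : Estimator d N) (τ : Matrix (Fin d) (Fin d) ℂ) (θ : ℝ) : ℝ :=
  ∑ j, T.prob τ j * (θ - T.estimate j) ^ 2

/-- Unbiasedness at the parameter value `θ`, in the sense of the quantum Cramér–Rao bound:
for the family `t ↦ τ t`, the identity `E_t(estimate) = t` holds at `t = θ` to first order. -/
def Estimator.IsUnbiasedAt {d N : ℕ} (T : Estimator d N)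
    (τ : ℝ → Matrix (Fin d) (Fin d) ℂ) (θ : ℝ) : Prop :=
  T.mean (τ θ) = θ ∧ HasDerivAt (fun t => T.mean (τ t)) 1 θ

/-- The sample complexity `N_α(E)`: the least `N ≥ 1` such that some unbiased estimator based on
`E(ρ_θ)^{⊗N}` has mean squared error at most `α` (`⊤` if there is none). -/
def sampleComplexity {d : ℕ} (E : QuantumChannel d) (ρ : ℝ → Matrix (Fin d) (Fin d) ℂ)
    (θ α : ℝ) : ℕ∞ :=
  ⨅ (N : ℕ) (_ : 1 ≤ N) (T : Estimator d N)
    (_ : T.IsUnbiasedAt (fun t => E.toLinearMap (ρ t)) θ)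
    (_ : T.mse (E.toLinearMap (ρ θ)) θ ≤ α), (N : ℕ∞)

/-- The best-case sample complexity: the infimum of `N_α(E)` over all `ε`-LDP channels `E`. -/
def bestCaseSampleComplexity {d : ℕ} (ε : ℝ) (ρ : ℝ → Matrix (Fin d) (Fin d) ℂ)
    (θ α : ℝ) : ℕ∞ :=
  ⨅ (E : QuantumChannel d) (_ : E.IsLDP ε), sampleComplexity E ρ θ α

/-- The entrywise derivative `∂ρ_θ/∂θ`. -/
def stateDeriv {d : ℕ} (ρ : ℝ → Matrix (Fin d) (Fin d) ℂ) (θ : ℝ) :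
    Matrix (Fin d) (Fin d) ℂ :=
  Matrix.of fun i j => deriv (fun t => ρ t i j) θ

/-- The Hilbert–Schmidt norm `√Tr(A† A)`. -/
def hsNorm {d : ℕ} (A : Matrix (Fin d) (Fin d) ℂ) : ℝ :=
  Real.sqrt (∑ i, ∑ j, ‖A i j‖ ^ 2)

end QuantumLDP

end

/-! One explicit estimator does everything. Let `A = stateDeriv ρ θ` have eigenvalues `a k` and put
`S = Tr A² = ‖A‖₂²`. Measure each depolarized copy separately in an eigenbasis of `A` and average an
affine function of the observed eigenvalue. Depolarizing scales the derivative to `(1 - p) A`, so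
dividing the observable by `(1 - p) S` makes the mean have slope `1`. Every outcome has probability
at most `p / d + (1 - p)`, so the single-copy variance is at most `(p / d + 1 - p) / ((1 - p)² S)`.
For the given `p` this equals `e^ε (d - 1 + e^ε) / ((e^ε - 1)² S)`. It is linear in `d`, although
`(1 - p)⁻²` is quadratic, because the outcome probabilities are themselves `O(1 / d)` when `ε ≤ 1`.
Averaging over `N` copies divides the variance by `N` (`mse_productEstimator`), and
`sampleComplexity_depolarizingChannel_le` turns this into a sample bound. Privacy holds because
`Tr(Mρ) ≤ Tr M`: the signal part is dominated by the uniform noise (`depolarizingChannel_isLDP`). -/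

namespace QuantumLDP

open Matrix

/-! ### Moments of a product distribution -/

section Moments

variable {ι κ : Type*} [Fintype ι] [DecidableEq ι] [Fintype κ]

theorem sum_prod_eq_prod_sum {R : Type*} [CommSemiring R] (h : ι → κ → R) :
    ∑ f : ι → κ, ∏ s, h s (f s) = ∏ s, ∑ k, h s k := by
  classical
  rw [Finset.prod_univ_sum, Fintype.piFinset_univ]

/-- Writing `g (f a)` as a product of factors that are `1` off `a` lets the sum factorize;
normalization removes the other coordinates. -/
theorem sum_prod_mul_apply (q g : κ → ℝ) (hq : ∑ k, q k = 1) (a : ι) :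
    ∑ f : ι → κ, (∏ s, q (f s)) * g (f a) = ∑ k, q k * g k := by
  have h : ∀ f : ι → κ, (∏ s, q (f s)) * g (f a)
      = ∏ s, q (f s) * (if s = a then g (f s) else 1) := by
    intro f
    rw [Finset.prod_mul_distrib, Finset.prod_ite_eq' Finset.univ a]
    simp
  simp_rw [h]
  rw [sum_prod_eq_prod_sum (fun s k => q k * (if s = a then g k else 1)),
    Finset.prod_eq_single a]
  · simp
  · intro b _ hb
    simp [hb, hq]
  · simp

theorem sum_prod_mul_apply_mul_apply (q g : κ → ℝ) (hg : ∑ k, q k * g k = 0) {a b : ι}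
    (hab : a ≠ b) : ∑ f : ι → κ, (∏ s, q (f s)) * (g (f a) * g (f b)) = 0 := by
  have h : ∀ f : ι → κ, (∏ s, q (f s)) * (g (f a) * g (f b))
      = ∏ s, q (f s) * ((if s = a then g (f s) else 1) * (if s = b then g (f s) else 1)) := by
    intro f
    rw [Finset.prod_mul_distrib, Finset.prod_mul_distrib, Finset.prod_ite_eq' Finset.univ a,
      Finset.prod_ite_eq' Finset.univ b]
    simp
  simp_rw [h]
  rw [sum_prod_eq_prod_sum
    (fun s k => q k * ((if s = a then g k else 1) * (if s = b then g k else 1)))]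
  apply Finset.prod_eq_zero (Finset.mem_univ a)
  simp [hab, hg]

theorem sum_prod_mul_sum (q g : κ → ℝ) (hq : ∑ k, q k = 1) :
    ∑ f : ι → κ, (∏ s, q (f s)) * ∑ a, g (f a) = Fintype.card ι * ∑ k, q k * g k := by
  simp_rw [Finset.mul_sum]
  rw [Finset.sum_comm]
  simp_rw [sum_prod_mul_apply q g hq]
  simp [Finset.mul_sum]

/-- Variances of independent centred variables add: cross terms vanish and only the diagonal
survives. -/
theorem sum_prod_mul_sum_sq (q g : κ → ℝ) (hq : ∑ k, q k = 1) (hg : ∑ k, q k * g k = 0) :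
    ∑ f : ι → κ, (∏ s, q (f s)) * (∑ a, g (f a)) ^ 2
      = Fintype.card ι * ∑ k, q k * g k ^ 2 := by
  simp_rw [sq, Finset.sum_mul_sum, Finset.mul_sum]
  rw [Finset.sum_comm]
  have h : ∀ a : ι, ∑ f : ι → κ, ∑ b, (∏ s, q (f s)) * (g (f a) * g (f b))
      = ∑ k, q k * (g k * g k) := by
    intro a
    rw [Finset.sum_comm, Finset.sum_eq_single a]
    · exact sum_prod_mul_apply q (fun k => g k * g k) hq a
    · intro b _ hb
      exact sum_prod_mul_apply_mul_apply q g hg hb.symm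
    · simp
  simp_rw [h]
  simp [Finset.mul_sum]

end Moments

/-! ### Populations of a state in an orthonormal basis -/

section Populations

variable {d : ℕ}

/-- The probability of outcome `k` when `τ` is measured in the basis of columns of `U`. -/
def population (U τ : Matrix (Fin d) (Fin d) ℂ) (k : Fin d) : ℝ :=
  ((star U * τ * U) k k).re

theorem population_eq_sum (U τ : Matrix (Fin d) (Fin d) ℂ) (k : Fin d) :
    (star U * τ * U) k k = ∑ i, ∑ j, U i k * star (U j k) * τ j i := by
  simp only [mul_apply, star_apply, Finset.sum_mul]
  refine Finset.sum_congr rfl fun i _ => Finset.sum_congr rfl fun j _ => ?_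
  ring

theorem posSemidef_conj {τ : Matrix (Fin d) (Fin d) ℂ} (hτ : τ.PosSemidef)
    (U : Matrix (Fin d) (Fin d) ℂ) : (star U * τ * U).PosSemidef := by
  rw [star_eq_conjTranspose]
  exact hτ.conjTranspose_mul_mul_same U

theorem population_nonneg {τ : Matrix (Fin d) (Fin d) ℂ} (hτ : τ.PosSemidef)
    (U : Matrix (Fin d) (Fin d) ℂ) (k : Fin d) : 0 ≤ population U τ k :=
  (Complex.le_def.1 ((posSemidef_conj hτ U).diag_nonneg (i := k))).1

theorem ofReal_population {τ : Matrix (Fin d) (Fin d) ℂ} (hτ : τ.PosSemidef)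
    (U : Matrix (Fin d) (Fin d) ℂ) (k : Fin d) :
    (population U τ k : ℂ) = (star U * τ * U) k k := by
  apply Complex.ext
  · rfl
  · exact (Complex.le_def.1 ((posSemidef_conj hτ U).diag_nonneg (i := k))).2

theorem trace_mul_eq_sum_population {U : Matrix (Fin d) (Fin d) ℂ} {A : Matrix (Fin d) (Fin d) ℂ}
    {a : Fin d → ℝ} (hA : A = U * diagonal (fun k => (a k : ℂ)) * star U)
    (τ : Matrix (Fin d) (Fin d) ℂ) :
    (A * τ).trace.re = ∑ k, population U τ k * a k := by
  have h : (A * τ).trace = ((star U * τ * U) * diagonal (fun k => (a k : ℂ))).trace := by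
    rw [hA, Matrix.mul_assoc, Matrix.mul_assoc, trace_mul_comm, Matrix.mul_assoc, trace_mul_comm,
      Matrix.mul_assoc, Matrix.mul_assoc]
  rw [h, trace, Complex.re_sum]
  refine Finset.sum_congr rfl fun k _ => ?_
  rw [diag_apply, mul_diagonal, Complex.re_mul_ofReal, population]

theorem sum_population {U : Matrix (Fin d) (Fin d) ℂ} (hU : U * star U = 1)
    {τ : Matrix (Fin d) (Fin d) ℂ} (hτ : τ.trace = 1) : ∑ k, population U τ k = 1 := by
  have h := trace_mul_eq_sum_population (U := U) (A := 1) (a := fun _ => 1)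
    (by simp [hU]) τ
  simpa [hτ] using h.symm

theorem population_le_one {U : Matrix (Fin d) (Fin d) ℂ} (hU : U * star U = 1)
    {τ : Matrix (Fin d) (Fin d) ℂ} (hτ : IsDensity τ) (k : Fin d) : population U τ k ≤ 1 := by
  rw [← sum_population hU hτ.trace_eq_one]
  exact Finset.single_le_sum (fun i _ => population_nonneg hτ.posSemidef U i) (Finset.mem_univ k)

theorem exists_spectral_decomposition {A : Matrix (Fin d) (Fin d) ℂ} (hA : A.IsHermitian) :
    ∃ U : Matrix (Fin d) (Fin d) ℂ, U * star U = 1 ∧ star U * U = 1 ∧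
      A = U * diagonal (fun k => (hA.eigenvalues k : ℂ)) * star U := by
  refine ⟨hA.eigenvectorUnitary, Unitary.coe_mul_star_self _, Unitary.coe_star_mul_self _, ?_⟩
  conv_lhs => rw [hA.spectral_theorem, Unitary.conjStarAlgAut_apply]
  rfl

theorem trace_mul_nonneg {M τ : Matrix (Fin d) (Fin d) ℂ} (hM : M.PosSemidef)
    (hτ : τ.PosSemidef) : 0 ≤ (M * τ).trace.re := by
  obtain ⟨U, -, -, hMU⟩ := exists_spectral_decomposition hM.isHermitian
  rw [trace_mul_eq_sum_population hMU]
  exact Finset.sum_nonneg fun k _ =>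
    mul_nonneg (population_nonneg hτ U k) (hM.eigenvalues_nonneg k)

theorem trace_mul_le_trace {M τ : Matrix (Fin d) (Fin d) ℂ} (hM : M.PosSemidef)
    (hτ : IsDensity τ) : (M * τ).trace.re ≤ M.trace.re := by
  obtain ⟨U, hU, hU', hMU⟩ := exists_spectral_decomposition hM.isHermitian
  -- With `τ = 1` every population is `1`, so `Tr M` becomes comparable term by term with `Tr(Mτ)`.
  have h1 := trace_mul_eq_sum_population hMU 1
  rw [Matrix.mul_one] at h1
  rw [trace_mul_eq_sum_population hMU, h1]
  refine Finset.sum_le_sum fun k _ =>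
    mul_le_mul_of_nonneg_right ?_ (hM.eigenvalues_nonneg k)
  have : population U 1 k = 1 := by simp [population, hU']
  rw [this]
  exact population_le_one hU hτ k

theorem trace_mul_self_re {A : Matrix (Fin d) (Fin d) ℂ} (hA : A.IsHermitian) :
    (A * A).trace.re = hsNorm A ^ 2 := by
  rw [hsNorm, Real.sq_sqrt (by positivity), trace, Complex.re_sum]
  refine Finset.sum_congr rfl fun i _ => ?_
  rw [diag_apply, mul_apply, Complex.re_sum]
  refine Finset.sum_congr rfl fun j _ => ?_
  rw [← hA.apply j i, Complex.star_def, Complex.mul_conj, Complex.ofReal_re,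
    Complex.normSq_eq_norm_sq]

end Populations

/-! ### Product measurements -/

section ProductEstimator

variable {d N : ℕ}

/-- The product vector with components `U · (f s)`, as a vector on `(ℂ^d)^{⊗N}`. -/
def productVector (U : Matrix (Fin d) (Fin d) ℂ) (f : Fin N → Fin d) (y : Fin N → Fin d) : ℂ :=
  ∏ s, U (y s) (f s)

/-- Measure every copy in the orthonormal basis of columns of `U` and report the average of the
single-copy estimates `x`. -/
noncomputable def productEstimator (N : ℕ) (U : Matrix (Fin d) (Fin d) ℂ) (hU : U * star U = 1)
    (x : Fin d → ℝ) : Estimator d N where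
  outcomes := Fintype.card (Fin N → Fin d)
  effect j := vecMulVec (productVector U ((Fintype.equivFin (Fin N → Fin d)).symm j))
    (star (productVector U ((Fintype.equivFin (Fin N → Fin d)).symm j)))
  effect_posSemidef j := posSemidef_vecMulVec_self_star _
  sum_effect := by
    rw [Equiv.sum_comp (Fintype.equivFin (Fin N → Fin d)).symm
      (fun f => vecMulVec (productVector U f) (star (productVector U f)))]
    ext y z
    simp only [Matrix.sum_apply, vecMulVec_apply, productVector, Pi.star_apply, star_prod, ← Finset.prod_mul_distrib]
    rw [sum_prod_eq_prod_sum (fun s k => U (y s) k * star (U (z s) k))]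
    have h : ∀ s, ∑ k, U (y s) k * star (U (z s) k)
        = (1 : Matrix (Fin d) (Fin d) ℂ) (y s) (z s) := by
      intro s
      rw [← hU, mul_apply]
      rfl
    simp_rw [h, one_apply]
    rw [Finset.prod_ite_zero]
    simp [funext_iff]
  estimate j := (∑ s, x ((Fintype.equivFin (Fin N → Fin d)).symm j s)) / N

/-- A product effect on a product state has a product of populations as its probability. Keeping `F`
general serves both the mean and the squared error. -/
theorem sum_outcomes_productEstimator {U : Matrix (Fin d) (Fin d) ℂ} (hU : U * star U = 1)
    (x : Fin d → ℝ) {τ : Matrix (Fin d) (Fin d) ℂ} (hτ : τ.PosSemidef) (F : ℝ → ℝ) :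
    ∑ j, (productEstimator N U hU x).prob τ j * F ((productEstimator N U hU x).estimate j)
      = ∑ f : Fin N → Fin d, (∏ s, population U τ (f s)) * F ((∑ s, x (f s)) / N) := by
  refine Fintype.sum_equiv (Fintype.equivFin (Fin N → Fin d)).symm _ _ fun j => ?_
  change _ = _ * F ((productEstimator N U hU x).estimate j)
  congr 1
  simp only [Estimator.prob, productEstimator, trace, diag_apply, mul_apply, tensorPower, of_apply,
    vecMulVec_apply, productVector, Pi.star_apply, star_prod, ← Finset.prod_mul_distrib]
  set f := (Fintype.equivFin (Fin N → Fin d)).symm j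
  have h : ∀ y : Fin N → Fin d,
      ∑ z : Fin N → Fin d, ∏ s, U (y s) (f s) * star (U (z s) (f s)) * τ (z s) (y s)
        = ∏ s, ∑ l, U (y s) (f s) * star (U l (f s)) * τ l (y s) := fun y =>
    sum_prod_eq_prod_sum (fun s l => U (y s) (f s) * star (U l (f s)) * τ l (y s))
  simp_rw [h]
  rw [sum_prod_eq_prod_sum (fun s i => ∑ l, U i (f s) * star (U l (f s)) * τ l i)]
  simp_rw [← population_eq_sum, ← ofReal_population hτ]
  rw [← Complex.ofReal_prod, Complex.ofReal_re]

theorem mean_productEstimator (hN : N ≠ 0) {U : Matrix (Fin d) (Fin d) ℂ} (hU : U * star U = 1)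
    (x : Fin d → ℝ) {τ : Matrix (Fin d) (Fin d) ℂ} (hτ : IsDensity τ) :
    (productEstimator N U hU x).mean τ = ∑ k, population U τ k * x k := by
  have hN' : (N : ℝ) ≠ 0 := by exact_mod_cast hN
  refine (sum_outcomes_productEstimator hU x hτ.posSemidef id).trans ?_
  simp only [id, ← mul_div_assoc, ← Finset.sum_div]
  rw [sum_prod_mul_sum _ _ (sum_population hU hτ.trace_eq_one), Fintype.card_fin]
  field_simp

theorem mse_productEstimator (hN : N ≠ 0) {U : Matrix (Fin d) (Fin d) ℂ} (hU : U * star U = 1)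
    (x : Fin d → ℝ) {τ : Matrix (Fin d) (Fin d) ℂ} (hτ : IsDensity τ) {θ : ℝ}
    (hθ : ∑ k, population U τ k * x k = θ) :
    (productEstimator N U hU x).mse τ θ = (∑ k, population U τ k * (x k - θ) ^ 2) / N := by
  have hN' : (N : ℝ) ≠ 0 := by exact_mod_cast hN
  have hq := sum_population hU hτ.trace_eq_one
  refine (sum_outcomes_productEstimator hU x hτ.posSemidef (fun e => (θ - e) ^ 2)).trans ?_
  have h : ∀ f : Fin N → Fin d,
      (θ - (∑ s, x (f s)) / N) ^ 2 = (∑ s, (x (f s) - θ)) ^ 2 / (N : ℝ) ^ 2 := by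
    intro f
    rw [Finset.sum_sub_distrib]
    simp only [Finset.sum_const, Finset.card_univ, Fintype.card_fin, nsmul_eq_mul]
    field_simp
    ring
  simp only [h, ← mul_div_assoc, ← Finset.sum_div]
  rw [sum_prod_mul_sum_sq (population U τ) (fun k => x k - θ) hq
    (by simp [mul_sub, Finset.sum_sub_distrib, hθ, ← Finset.sum_mul, hq]), Fintype.card_fin]
  field_simp

end ProductEstimator

/-! ### The global depolarizing channel -/

section Depolarizing

variable {d : ℕ}

/-- The trace term ampliates to (partial trace) ⊗ `1`. The partial trace is a sum of principal
submatrices, hence positivity is preserved. -/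
theorem ampliation_depolarizingMap (p : ℝ) (k : ℕ)
    (X : Matrix (Fin k × Fin d) (Fin k × Fin d) ℂ) :
    ampliation (depolarizingMap d p) k X
      = ((p / d : ℝ) : ℂ) • kronecker
          (∑ i : Fin d, X.submatrix (fun a : Fin k => (a, i)) (fun a => (a, i)))
          (1 : Matrix (Fin d) (Fin d) ℂ) + ((1 - p : ℝ) : ℂ) • X := by
  ext ⟨a, i⟩ ⟨b, j⟩
  simp [ampliation, depolarizingMap, trace, Matrix.sum_apply, kronecker, one_apply]

/-- The global depolarizing channel, for `0 ≤ p ≤ 1`. -/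
noncomputable def depolarizingChannel (hd : d ≠ 0) {p : ℝ} (hp0 : 0 ≤ p) (hp1 : p ≤ 1) : QuantumChannel d where
  toLinearMap := depolarizingMap d p
  completelyPositive k X hX := by
    rw [ampliation_depolarizingMap]
    refine PosSemidef.add (PosSemidef.smul (PosSemidef.kronecker ?_ PosSemidef.one) ?_)
      (hX.smul ?_)
    · exact posSemidef_sum _ fun i _ => hX.submatrix _
    · exact_mod_cast div_nonneg hp0 (Nat.cast_nonneg d)
    · exact_mod_cast sub_nonneg.2 hp1
  tracePreserving X := by
    have hd' : (d : ℂ) ≠ 0 := by exact_mod_cast hd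
    simp only [depolarizingMap, LinearMap.coe_mk, AddHom.coe_mk, trace_add, trace_smul, trace_one,
      Fintype.card_fin, smul_eq_mul]
    push_cast
    field_simp
    ring

theorem re_trace_mul_depolarizingMap (p : ℝ) (M : Matrix (Fin d) (Fin d) ℂ)
    {ρ : Matrix (Fin d) (Fin d) ℂ} (hρ : ρ.trace = 1) :
    (M * depolarizingMap d p ρ).trace.re
      = p / d * M.trace.re + (1 - p) * (M * ρ).trace.re := by
  simp [depolarizingMap, hρ, Matrix.mul_add, trace_add, trace_smul, -Complex.ofReal_div,
    -Complex.ofReal_sub]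

theorem depolarizingChannel_isLDP (hd : d ≠ 0) {p ε : ℝ} (hp0 : 0 ≤ p) (hp1 : p ≤ 1)
    (hp : 1 - p ≤ (Real.exp ε - 1) * (p / d)) :
    (depolarizingChannel hd hp0 hp1).IsLDP ε := by
  intro M ρ σ hM _ hρ hσ
  change (M * depolarizingMap d p ρ).trace.re ≤ _ * (M * depolarizingMap d p σ).trace.re
  rw [re_trace_mul_depolarizingMap p M hρ.trace_eq_one,
    re_trace_mul_depolarizingMap p M hσ.trace_eq_one]
  have h1 := trace_mul_le_trace hM hρ
  have h2 : 0 ≤ (M * ρ).trace.re := trace_mul_nonneg hM hρ.posSemidef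
  have h3 : 0 ≤ (M * σ).trace.re := trace_mul_nonneg hM hσ.posSemidef
  -- Chain: `(1 - p) Tr(Mρ) ≤ (1 - p) Tr M ≤ (e^ε - 1) (p / d) Tr M`.
  have h4 := mul_le_mul_of_nonneg_left h1 (sub_nonneg.2 hp1)
  have h5 := mul_le_mul_of_nonneg_right hp (h2.trans h1)
  have h6 : 0 ≤ Real.exp ε * ((1 - p) * (M * σ).trace.re) :=
    mul_nonneg (Real.exp_pos ε).le (mul_nonneg (sub_nonneg.2 hp1) h3)
  linarith

theorem depolarizingMap_isDensity (hd : d ≠ 0) {p : ℝ} (hp0 : 0 ≤ p) (hp1 : p ≤ 1)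
    {ρ : Matrix (Fin d) (Fin d) ℂ} (hρ : IsDensity ρ) : IsDensity (depolarizingMap d p ρ) where
  posSemidef := by
    simp only [depolarizingMap, LinearMap.coe_mk, AddHom.coe_mk, hρ.trace_eq_one, mul_one]
    refine PosSemidef.add (PosSemidef.one.smul ?_) (hρ.posSemidef.smul ?_)
    · exact_mod_cast div_nonneg hp0 (Nat.cast_nonneg d)
    · exact_mod_cast sub_nonneg.2 hp1
  trace_eq_one :=
    ((depolarizingChannel hd hp0 hp1).tracePreserving ρ).trans hρ.trace_eq_one

theorem population_depolarizingMap_le {p : ℝ} (hp1 : p ≤ 1) {U : Matrix (Fin d) (Fin d) ℂ}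
    (hU : U * star U = 1) (hU' : star U * U = 1) {ρ : Matrix (Fin d) (Fin d) ℂ}
    (hρ : IsDensity ρ) (k : Fin d) :
    population U (depolarizingMap d p ρ) k ≤ p / d + (1 - p) := by
  have h : population U (depolarizingMap d p ρ) k = p / d + (1 - p) * population U ρ k := by
    simp [population, depolarizingMap, hρ.trace_eq_one, Matrix.mul_add, Matrix.add_mul, hU',
      -Complex.ofReal_div, -Complex.ofReal_sub]
  rw [h]
  have := mul_le_mul_of_nonneg_left (population_le_one hU hρ k) (sub_nonneg.2 hp1)
  linarith

end Depolarizing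

/-! ### Derivatives of families of states -/

section Derivative

variable {d : ℕ} {ρ : ℝ → Matrix (Fin d) (Fin d) ℂ} {θ : ℝ}

theorem stateDeriv_isHermitian (hρ : ∀ t, (ρ t).IsHermitian) : (stateDeriv ρ θ).IsHermitian := by
  ext i j
  simp only [stateDeriv, conjTranspose_apply, of_apply]
  rw [← deriv.star]
  congr 1
  ext t
  exact (hρ t).apply i j

theorem hasDerivAt_re_trace_mul (hρ : ∀ i j, DifferentiableAt ℝ (fun t => ρ t i j) θ)
    (A : Matrix (Fin d) (Fin d) ℂ) :
    HasDerivAt (fun t => (A * ρ t).trace.re) (A * stateDeriv ρ θ).trace.re θ := by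
  have h : HasDerivAt (fun t => (A * ρ t).trace) (A * stateDeriv ρ θ).trace θ := by
    simp only [trace, diag_apply, mul_apply, stateDeriv, of_apply]
    exact HasDerivAt.fun_sum fun i _ => HasDerivAt.fun_sum fun j _ =>
      (hρ j i).hasDerivAt.const_mul _
  exact Complex.reCLM.hasFDerivAt.comp_hasDerivAt θ h

end Derivative

/-! ### Sample complexity of the depolarizing channel -/

variable {d : ℕ} {ρ : ℝ → Matrix (Fin d) (Fin d) ℂ} {θ : ℝ}

theorem sampleComplexity_le {E : QuantumChannel d} {α : ℝ} {N : ℕ} (hN : 1 ≤ N)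
    (T : Estimator d N) (hT : T.IsUnbiasedAt (fun t => E.toLinearMap (ρ t)) θ)
    (hα : T.mse (E.toLinearMap (ρ θ)) θ ≤ α) : sampleComplexity E ρ θ α ≤ N :=
  iInf_le_of_le N (iInf_le_of_le hN (iInf_le_of_le T (iInf₂_le hT hα)))

theorem sampleComplexity_depolarizingChannel_le (hd : d ≠ 0) {p : ℝ} (hp0 : 0 ≤ p) (hp1 : p < 1)
    (hρ : ∀ t, IsDensity (ρ t)) (hdiff : ∀ i j, DifferentiableAt ℝ (fun t => ρ t i j) θ)
    (hA : 0 < hsNorm (stateDeriv ρ θ)) {α : ℝ} {N : ℕ} (hN : 1 ≤ N)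
    (hα : (p / d + (1 - p)) / ((1 - p) ^ 2 * hsNorm (stateDeriv ρ θ) ^ 2) / N ≤ α) :
    sampleComplexity (depolarizingChannel hd hp0 hp1.le) ρ θ α ≤ N := by
  have hAh : (stateDeriv ρ θ).IsHermitian :=
    stateDeriv_isHermitian fun t => (hρ t).posSemidef.isHermitian
  obtain ⟨A, hAdef⟩ : ∃ A, A = stateDeriv ρ θ := ⟨_, rfl⟩
  rw [← hAdef] at hAh hA hα
  obtain ⟨U, hU, hU', hAU⟩ := exists_spectral_decomposition hAh
  set a := hAh.eigenvalues
  set S := hsNorm A ^ 2 with hS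
  have hS0 : 0 < S := by positivity
  have hp : 0 < 1 - p := sub_pos.2 hp1
  have hdens : ∀ t, IsDensity (depolarizingMap d p (ρ t)) := fun t =>
    depolarizingMap_isDensity hd hp0 hp1.le (hρ t)
  set τ : ℝ → Matrix (Fin d) (Fin d) ℂ := fun t => depolarizingMap d p (ρ t) with hτ
  have hτ1 : ∀ t, ∑ k, population U (τ t) k = 1 := fun t =>
    sum_population hU (hdens t).trace_eq_one
  have hτa : ∀ t, ∑ k, population U (τ t) k * a k = (A * τ t).trace.re := fun t =>
    (trace_mul_eq_sum_population hAU (τ t)).symm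
  have hSa : ∑ k, a k ^ 2 = S := by
    rw [hS, ← trace_mul_self_re hAh, trace_mul_eq_sum_population hAU A]
    refine Finset.sum_congr rfl fun k _ => ?_
    have : star U * A * U = diagonal (fun k => (a k : ℂ)) := by
      nth_rw 1 [hAU]
      rw [← Matrix.mul_assoc, ← Matrix.mul_assoc, hU', Matrix.one_mul, Matrix.mul_assoc, hU',
        Matrix.mul_one]
    rw [population, this, diagonal_apply_eq, Complex.ofReal_re, sq]
  set μ := (A * τ θ).trace.re with hμ
  -- Centring at `μ` gives mean `θ`; the scale `(1 - p) * S` is the derivative of `Tr(A τ t)` at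
  -- `θ`.
  set x : Fin d → ℝ := fun k => θ + (a k - μ) / ((1 - p) * S) with hx
  have hmean : ∀ t, ∑ k, population U (τ t) k * x k
      = θ + ((A * τ t).trace.re - μ) / ((1 - p) * S) := by
    intro t
    simp only [hx, mul_add, Finset.sum_add_distrib, ← Finset.sum_mul, hτ1, one_mul,
      ← mul_div_assoc, ← Finset.sum_div, mul_sub, Finset.sum_sub_distrib, hτa]
  have hmeanθ : ∑ k, population U (τ θ) k * x k = θ := by
    rw [hmean]
    simp [hμ]
  have hN0 : N ≠ 0 := by omega
  refine sampleComplexity_le hN (productEstimator N U hU x) ⟨?_, ?_⟩ ?_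
  · exact (mean_productEstimator hN0 hU x (hdens θ)).trans hmeanθ
  · have h : (fun t => (productEstimator N U hU x).mean (τ t))
        = fun t => θ + (p / d * A.trace.re + (1 - p) * (A * ρ t).trace.re - μ)
            / ((1 - p) * S) := by
      funext t
      rw [mean_productEstimator hN0 hU x (hdens t), hmean, hτ,
        re_trace_mul_depolarizingMap p A (hρ t).trace_eq_one]
    change HasDerivAt (fun t => (productEstimator N U hU x).mean (τ t)) 1 θ
    rw [h]
    have hder := hasDerivAt_re_trace_mul hdiff A
    rw [← hAdef, trace_mul_self_re hAh, ← hS] at hder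
    exact (((((hder.const_mul (1 - p)).const_add (p / d * A.trace.re)).sub_const μ).div_const
      ((1 - p) * S)).const_add θ).congr_deriv (div_self (mul_pos hp hS0).ne')
  · refine le_trans ?_ hα
    change (productEstimator N U hU x).mse (τ θ) θ ≤ _
    rw [mse_productEstimator hN0 hU x (hdens θ) hmeanθ]
    refine div_le_div_of_nonneg_right ?_ (Nat.cast_nonneg N)
    have h1 : ∑ k, population U (τ θ) k * (x k - θ) ^ 2
        = (∑ k, population U (τ θ) k * a k ^ 2 - μ ^ 2) / ((1 - p) * S) ^ 2 := by
      have h2 : ∀ k, population U (τ θ) k * (x k - θ) ^ 2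
          = (population U (τ θ) k * a k ^ 2 - 2 * μ * (population U (τ θ) k * a k)
            + μ ^ 2 * population U (τ θ) k) / ((1 - p) * S) ^ 2 := by
        intro k
        simp only [hx, add_sub_cancel_left, div_pow]
        ring
      simp_rw [h2]
      rw [← Finset.sum_div, Finset.sum_add_distrib, Finset.sum_sub_distrib, ← Finset.mul_sum,
        ← Finset.mul_sum, hτ1, hτa, ← hμ]
      ring
    have h3 : ∑ k, population U (τ θ) k * a k ^ 2 ≤ (p / d + (1 - p)) * S := by
      rw [← hSa, Finset.mul_sum]
      exact Finset.sum_le_sum fun k _ => mul_le_mul_of_nonneg_right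
        (population_depolarizingMap_le hp1.le hU hU' (hρ θ) k) (sq_nonneg _)
    rw [h1]
    calc (∑ k, population U (τ θ) k * a k ^ 2 - μ ^ 2) / ((1 - p) * S) ^ 2
        ≤ ((p / d + (1 - p)) * S) / ((1 - p) * S) ^ 2 := by
          gcongr
          linarith [sq_nonneg μ]
      _ = (p / d + (1 - p)) / ((1 - p) ^ 2 * S) := by
          field_simp

/-- At the privacy level `ε ≤ 1`, the single-copy variance is `O(d / ε²)`. -/
theorem depolarizing_variance_le {d ε m h : ℝ} (hd : 1 ≤ d) (hε0 : 0 < ε) (hε1 : ε ≤ 1)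
    (hm : 0 < m) (hmh : m ≤ h) {p : ℝ} (hp : p = d / (d - 1 + Real.exp ε)) :
    (p / d + (1 - p)) / ((1 - p) ^ 2 * h ^ 2) ≤ 9 * d / (ε ^ 2 * m ^ 2) := by
  have he : ε + 1 ≤ Real.exp ε := Real.add_one_le_exp ε
  have he1 : Real.exp ε ≤ 3 :=
    (Real.exp_le_exp.2 hε1).trans (Real.exp_one_lt_d9.le.trans (by norm_num))
  have hD : 0 < d - 1 + Real.exp ε := by linarith
  have he2 : 0 < Real.exp ε - 1 := by linarith
  have hh : 0 < h := hm.trans_le hmh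
  have h1 : (p / d + (1 - p)) / ((1 - p) ^ 2 * h ^ 2)
      = Real.exp ε * (d - 1 + Real.exp ε) / ((Real.exp ε - 1) ^ 2 * h ^ 2) := by
    have hq : 1 - p = (Real.exp ε - 1) / (d - 1 + Real.exp ε) := by
      rw [hp]
      field_simp
      ring
    have hq' : p / d = 1 / (d - 1 + Real.exp ε) := by
      rw [hp]
      field_simp
    rw [hq, hq']
    field_simp
    ring
  rw [h1]
  -- Since `e^ε ≤ 3` and `d ≥ 1`, the second factor is at most `d + 2 ≤ 3 d`.
  have h2 : Real.exp ε * (d - 1 + Real.exp ε) ≤ 3 * (3 * d) :=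
    mul_le_mul he1 (by linarith) hD.le (by norm_num)
  have h3 : ε ≤ Real.exp ε - 1 := by linarith
  calc _ ≤ 9 * d / ((Real.exp ε - 1) ^ 2 * h ^ 2) := by
        refine div_le_div_of_nonneg_right ?_ (by positivity)
        linarith
    _ ≤ 9 * d / (ε ^ 2 * m ^ 2) := by gcongr

end QuantumLDP

/-! ### Choice of the privacy threshold and of the number of copies -/

theorem mainTheorem4 :
    ∃ c : ℝ, 0 < c ∧ ∀ m α₀ : ℝ, 0 < m → 0 < α₀ → ∃ ε₀ : ℝ, 0 < ε₀ ∧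
      ∀ (d : ℕ) (ρ : ℝ → Matrix (Fin d) (Fin d) ℂ) (θ : ℝ),
        (∀ t, QuantumLDP.IsDensity (ρ t)) →
        (∀ i j, ContDiff ℝ 1 (fun t => ρ t i j)) →
        m ≤ QuantumLDP.hsNorm (QuantumLDP.stateDeriv ρ θ) →
        ∀ α ε : ℝ, 0 < α → α ≤ α₀ → 0 < ε → ε < ε₀ →
          (QuantumLDP.bestCaseSampleComplexity ε ρ θ α : ℝ≥0∞)
              ≤ ENNReal.ofReal (c / m ^ 2 * (d * α⁻¹ * (ε ^ 2)⁻¹)) ∧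
          ∃ E : QuantumLDP.QuantumChannel d,
            E.toLinearMap = QuantumLDP.depolarizingMap d (d / (d - 1 + Real.exp ε)) ∧
            E.IsLDP ε ∧
            (QuantumLDP.sampleComplexity E ρ θ α : ℝ≥0∞)
              ≤ ENNReal.ofReal (c / m ^ 2 * (d * α⁻¹ * (ε ^ 2)⁻¹)) := by
  -- The constant is `9` from the variance bound times `2` for rounding `v / α` up to an integer.
  -- The second term of the minimum forces `v / α ≥ 1`, which is what makes the factor `2` suffice.
  refine ⟨18, by norm_num, fun m α₀ hm hα₀ =>
    ⟨min 1 (1 / (m * √α₀)), by positivity, ?_⟩⟩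
  intro d ρ θ hρ hC hmA α ε hα hαα₀ hε hεε₀
  have hd : d ≠ 0 := by
    rintro rfl
    simpa using (hρ θ).trace_eq_one
  have hd1 : (1 : ℝ) ≤ d := by exact_mod_cast Nat.one_le_iff_ne_zero.2 hd
  have hε1 : ε ≤ 1 := (hεε₀.trans_le (min_le_left _ _)).le
  have hsmall : α * (ε ^ 2 * m ^ 2) ≤ 1 := by
    have h1 : ε * (m * √α₀) ≤ 1 :=
      (le_div_iff₀ (by positivity)).1 (hεε₀.trans_le (min_le_right _ _)).le
    calc α * (ε ^ 2 * m ^ 2) ≤ α₀ * (ε ^ 2 * m ^ 2) := by gcongr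
      _ = (ε * (m * √α₀)) ^ 2 := by
        rw [mul_pow, mul_pow, Real.sq_sqrt hα₀.le]
        ring
      _ ≤ 1 := pow_le_one₀ (by positivity) h1
  have hD : (d : ℝ) < d - 1 + Real.exp ε := by linarith [Real.add_one_le_exp ε]
  have hD0 : (0 : ℝ) < d - 1 + Real.exp ε := by linarith
  obtain ⟨p, hp⟩ : ∃ p : ℝ, p = d / (d - 1 + Real.exp ε) := ⟨_, rfl⟩
  have hp0 : 0 ≤ p := by rw [hp]; positivity
  have hp1 : p < 1 := by rwa [hp, div_lt_one hD0]
  -- The stated `p` makes the sufficient condition for privacy an equality.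
  have hLDP : (QuantumLDP.depolarizingChannel hd hp0 hp1.le).IsLDP ε := by
    refine QuantumLDP.depolarizingChannel_isLDP hd hp0 hp1.le (le_of_eq ?_)
    rw [hp]
    field_simp
    ring
  have hvar := QuantumLDP.depolarizing_variance_le hd1 hε hε1 hm hmA hp
  obtain ⟨v, hv⟩ : ∃ v : ℝ, v = 9 * d / (ε ^ 2 * m ^ 2) := ⟨_, rfl⟩
  rw [← hv] at hvar
  have hvα : 1 ≤ v / α := by
    rw [hv, div_div, le_div_iff₀ (by positivity)]
    linarith
  have hN1 : 1 ≤ ⌈v / α⌉₊ := Nat.one_le_ceil_iff.2 (by linarith)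
  have hN2 : (⌈v / α⌉₊ : ℝ) ≤ 18 / m ^ 2 * (d * α⁻¹ * (ε ^ 2)⁻¹) := by
    have h1 := (Nat.ceil_lt_add_one (by linarith : 0 ≤ v / α)).le
    calc (⌈v / α⌉₊ : ℝ) ≤ 2 * (v / α) := by linarith
      _ = 18 / m ^ 2 * (d * α⁻¹ * (ε ^ 2)⁻¹) := by
        rw [hv]
        field_simp
        ring
  have hN : QuantumLDP.sampleComplexity (QuantumLDP.depolarizingChannel hd hp0 hp1.le) ρ θ α
      ≤ ⌈v / α⌉₊ := by
    refine QuantumLDP.sampleComplexity_depolarizingChannel_le hd hp0 hp1 hρ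
      (fun i j => (hC i j).differentiable one_ne_zero θ) (hm.trans_le hmA) hN1 ?_
    refine (div_le_div_of_nonneg_right hvar (Nat.cast_nonneg _)).trans ?_
    rw [div_le_iff₀ (by exact_mod_cast hN1), mul_comm]
    exact (div_le_iff₀ hα).1 (Nat.le_ceil _)
  have hbound : ∀ n : ℕ∞, n ≤ (⌈v / α⌉₊ : ℕ) →
      (n : ℝ≥0∞) ≤ ENNReal.ofReal (18 / m ^ 2 * (d * α⁻¹ * (ε ^ 2)⁻¹)) := by
    intro n hn
    refine (ENat.toENNReal_le.2 hn).trans ?_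
    rw [ENat.toENNReal_coe, ← ENNReal.ofReal_natCast]
    exact ENNReal.ofReal_le_ofReal hN2
  refine ⟨hbound _ (le_trans (iInf₂_le
    (f := fun E _ => QuantumLDP.sampleComplexity E ρ θ α) _ hLDP) hN), QuantumLDP.depolarizingChannel hd hp0 hp1.le,
    ?_, hLDP, hbound _ hN⟩
  rw [← hp]
  rfl
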